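/- Let $X$ be a real normed linear space, let $D$ be a nonempty subset of a real normed linear space, and let $\mathcal D$ be a set of functions $d:\mathbb R_+\to D$ (where $\mathbb R_+=[0,\infty)$) that is closed under time shifts $d\mapsto d(\tau+\cdot)$, $\tau\ge 0$, and under concatenation: for $d_1,d_2\in\mathcal D$ and $t>0$, the function equal to $d_1(s)$ for $s\in[0,t]$ and to $d_2(s-t)$ for $s>t$ lies in $\mathcal D$. Let $\Sigma=(X,\mathcal D,\phi)$ be a forward complete dynamical system, i.e. $\phi:\mathbb R_+\times X\times\mathcal D\to X$ satisfies, for all $t,h\ge0$, $x\in X$ and $d,\tilde d\in\mathcal D$: $\phi(0,x,d)=x$; $\phi(t,x,d)=\phi(t,x,\tilde d)$ whenever $d=\tilde d$ on $[0,t]$; the map $t\mapsto\phi(t,x,d)$ is continuous; and $\phi(h,\phi(t,x,d),d(t+\cdot))=\phi(t+h,x,d)$. Assume: - (Lipschitz continuous flow) for all $\tau>0$ and $r>0$ there is $L>0$ such that $\|\phi(t,x,d)-\phi(t,y,d)\|\le L\|x-y\|$ whenever $\|x\|,\|y\|\le r$, $t\in[0,\tau]$, $d\in\mathcal D$; - (robust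 forward completeness, RFC) for all $C>0$ and $\tau>0$, $\sup\{\|\phi(t,x,d)\| : \|x\|\le C,\ t\in[0,\tau],\ d\in\mathcal D\}<\infty$; - ($0$ is a robust equilibrium) $\phi(t,0,d)=0$ for all $t\ge0$, $d\in\mathcal D$, and for all $\varepsilon>0$ and $h>0$ there is $\delta>0$ such that $\|\phi(t,x,d)\|\le\varepsilon$ whenever $t\in[0,h]$, $\|x\|\le\delta$, $d\in\mathcal D$. Let $\mathcal K$ be the set of continuous strictly increasing $\gamma:\mathbb R_+\to\mathbb R_+$ with $\gamma(0)=0$; let $\mathcal K_\infty$ be the set of unbounded $\gamma\in\mathcal K$; let $\mathcal{KL}$ be the set of $\beta:\mathbb R_+^2\to\mathbb R_+$ such that $\beta(\cdot,t)\in\mathcal K$ for all $t\ge0$ and, for all $r>0$, $\beta(r,\cdot)$ is continuous and decreasing (not necessarily strictly) with $\lim_{t\to\infty}\beta(r,t)=0$. For continuous $V:X\to\mathbb R_+$ put $\dot V_d(x):=\liminf_{t\to+0}\frac1t\big(V(\phi(t,x,d))-V(x)\big)\in[-\infty,\infty]$. Then the following statements are equivalent: 1. (UGAS) There is $\beta\in\mathcal{KL}$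 such that $\|\phi(t,x,d)\|\le\beta(\|x\|,t)$ for all $x\in X$, $d\in\mathcal D$, $t\ge0$. 2. (UGATT) For all $r,\varepsilon>0$ there is $\tau\geq 0$ such that $\|\phi(t,x,d)\|\le\varepsilon$ whenever $\|x\|\le r$, $d\in\mathcal D$, $t\ge\tau$. 3. There is a coercive Lyapunov function, i.e. a continuous $V:X\to\mathbb R_+$ for which there exist $\psi_1,\psi_2\in\mathcal K_\infty$ and $\alpha\in\mathcal K$ with $\psi_1(\|x\|)\le V(x)\le\psi_2(\|x\|)$ and $\dot V_d(x)\le-\alpha(\|x\|)$ for all $x\in X$, $d\in\mathcal D$. 4. There is a non-coercive Lyapunov function, i.e. a continuous $V:X\to\mathbb R_+$ with $V(0)=0$ for which there exist $\psi_2\in\mathcal K_\infty$ and $\alpha\in\mathcal K$ with $0<V(x)\le\psi_2(\|x\|)$ for all $x\in X\setminus\{0\}$ and $\dot V_d(x)\le-\alpha(\|x\|)$ for all $x\in X$, $d\in\mathcal D$. -/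

import Mathlib

open scoped NNReal

namespace NonCoerciveLyapunov

/-! Comparison functions on the nonnegative reals. -/

/-- Class `K`: continuous, strictly increasing, zero at zero. -/
def IsClassK (γ : ℝ≥0 → ℝ≥0) : Prop :=
  Continuous γ ∧ StrictMono γ ∧ γ 0 = 0

/-- Class `K∞`: unbounded functions of class `K`. -/
def IsClassKInf (γ : ℝ≥0 → ℝ≥0) : Prop :=
  IsClassK γ ∧ ¬ BddAbove (Set.range γ)

/-- Class `L`: continuous, decreasing, with limit zero at infinity. -/
def IsClassL (γ : ℝ≥0 → ℝ≥0) : Prop :=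
  Continuous γ ∧ Antitone γ ∧ Filter.Tendsto γ Filter.atTop (nhds 0)

/-- Class `KL`: `β(·, t)` is of class `K` for all `t ≥ 0`, and `β(r, ·)` is of class `L` for all
`r > 0`. -/
def IsClassKL (β : ℝ≥0 → ℝ≥0 → ℝ≥0) : Prop :=
  (∀ t : ℝ≥0, IsClassK (fun r => β r t)) ∧ ∀ r : ℝ≥0, 0 < r → IsClassL (β r)

/-- The time shift `d(τ + ·)`. -/
def timeShift {D : Type*} (τ : ℝ≥0) (d : ℝ≥0 → D) : ℝ≥0 → D :=
  fun s => d (τ + s)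

/-- The concatenation of `d₁` and `d₂` at time `t`. The subtraction is only used for `s > t`. -/
noncomputable def concat {D : Type*} (t : ℝ≥0) (d₁ d₂ : ℝ≥0 → D) : ℝ≥0 → D :=
  fun s => if s ≤ t then d₁ s else d₂ (s - t)

/-- A forward complete, time-invariant dynamical system with state space `X` and disturbances with
values in a nonempty subset of the normed space `S`. Forward completeness is expressed by `flow`
being a total function. -/
structure DynSystem (X S : Type*) [NormedAddCommGroup X] [NormedSpace ℝ X]
    [NormedAddCommGroup S] [NormedSpace ℝ S] where
  /-- the set of disturbance values -/
  values : Set S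
  values_nonempty : values.Nonempty
  /-- the space of disturbances -/
  disturbances : Set (ℝ≥0 → values)
  /-- axiom of shift invariance -/
  shift_mem : ∀ d ∈ disturbances, ∀ τ : ℝ≥0, timeShift τ d ∈ disturbances
  /-- axiom of concatenation -/
  concat_mem : ∀ d₁ ∈ disturbances, ∀ d₂ ∈ disturbances, ∀ t : ℝ≥0, 0 < t → concat t d₁ d₂ ∈ disturbances
  /-- the transition map -/
  flow : ℝ≥0 → X → disturbances → X
  /-- identity property -/
  flow_zero : ∀ (x : X) (d : disturbances), flow 0 x d = x
  /-- causality -/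
  causality : ∀ (t : ℝ≥0) (x : X) (d d' : disturbances), (∀ s : ℝ≥0, s ≤ t → d.1 s = d'.1 s) →
    flow t x d = flow t x d'
  /-- continuity of trajectories -/
  continuous_flow : ∀ (x : X) (d : disturbances), Continuous (fun t => flow t x d)
  /-- cocycle property -/
  cocycle : ∀ (t h : ℝ≥0) (x : X) (d : disturbances),
    flow h (flow t x d) ⟨timeShift t d.1, shift_mem d.1 d.2 t⟩ = flow (t + h) x d

namespace DynSystem

variable {X S : Type*} [NormedAddCommGroup X] [NormedSpace ℝ X]
  [NormedAddCommGroup S] [NormedSpace ℝ S]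

/-- The flow is Lipschitz continuous on compact intervals. -/
def LipschitzFlow (Sys : DynSystem X S) : Prop :=
  ∀ τ : ℝ≥0, 0 < τ → ∀ r : ℝ, 0 < r → ∃ L : ℝ, 0 < L ∧
    ∀ x y : X, ‖x‖ ≤ r → ‖y‖ ≤ r → ∀ t : ℝ≥0, t ≤ τ → ∀ d : Sys.disturbances,
      ‖Sys.flow t x d - Sys.flow t y d‖ ≤ L * ‖x - y‖

/-- Robust forward completeness. -/
def RobustlyForwardComplete (Sys : DynSystem X S) : Prop :=
  ∀ C : ℝ, 0 < C → ∀ τ : ℝ≥0, 0 < τ →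
    BddAbove {y : ℝ | ∃ (x : X) (t : ℝ≥0) (d : Sys.disturbances),
      ‖x‖ ≤ C ∧ t ≤ τ ∧ y = ‖Sys.flow t x d‖}

/-- `0` is an equilibrium point. -/
def ZeroIsEquilibrium (Sys : DynSystem X S) : Prop :=
  ∀ (t : ℝ≥0) (d : Sys.disturbances), Sys.flow t 0 d = 0

/-- `0` is a robust equilibrium point. -/
def ZeroIsRobustEquilibrium (Sys : DynSystem X S) : Prop :=
  Sys.ZeroIsEquilibrium ∧
    ∀ ε : ℝ, 0 < ε → ∀ h : ℝ≥0, 0 < h → ∃ δ : ℝ, 0 < δ ∧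
      ∀ (t : ℝ≥0) (x : X) (d : Sys.disturbances), t ≤ h → ‖x‖ ≤ δ → ‖Sys.flow t x d‖ ≤ ε

/-- `0` is uniformly globally asymptotically stable. -/
def UGAS (Sys : DynSystem X S) : Prop :=
  ∃ β : ℝ≥0 → ℝ≥0 → ℝ≥0, IsClassKL β ∧
    ∀ (x : X) (d : Sys.disturbances) (t : ℝ≥0), ‖Sys.flow t x d‖₊ ≤ β ‖x‖₊ t

/-- `0` is uniformly globally attractive. -/
def UGATT (Sys : DynSystem X S) : Prop :=
  ∀ r ε : ℝ, 0 < r → 0 < ε → ∃ τ : ℝ≥0,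
    ∀ (x : X) (d : Sys.disturbances) (t : ℝ≥0), ‖x‖ ≤ r → τ ≤ t → ‖Sys.flow t x d‖ ≤ ε

/-- The right-hand lower Dini derivative at time `0` of `V` along the trajectory through `x` for
the disturbance `d`, as an extended real number. -/
noncomputable def diniDeriv (Sys : DynSystem X S) (V : X → ℝ≥0) (d : Sys.disturbances) (x : X) : EReal :=
  Filter.liminf
    (fun t : ℝ≥0 => ((((V (Sys.flow t x d) : ℝ) - (V x : ℝ)) / (t : ℝ) : ℝ) : EReal))
    (nhdsWithin 0 (Set.Ioi 0))

/-- `V` is a (coercive) Lyapunov function. -/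
def IsCoerciveLyapunov (Sys : DynSystem X S) (V : X → ℝ≥0) : Prop :=
  Continuous V ∧
    ∃ ψ₁ ψ₂ α : ℝ≥0 → ℝ≥0, IsClassKInf ψ₁ ∧ IsClassKInf ψ₂ ∧ IsClassK α ∧
      (∀ x : X, ψ₁ ‖x‖₊ ≤ V x ∧ V x ≤ ψ₂ ‖x‖₊) ∧
      ∀ (x : X) (d : Sys.disturbances), Sys.diniDeriv V d x ≤ ((-(α ‖x‖₊ : ℝ) : ℝ) : EReal)

/-- `V` is a non-coercive Lyapunov function. -/
def IsNonCoerciveLyapunov (Sys : DynSystem X S) (V : X → ℝ≥0) : Prop :=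
  Continuous V ∧ V 0 = 0 ∧
    ∃ ψ₂ α : ℝ≥0 → ℝ≥0, IsClassKInf ψ₂ ∧ IsClassK α ∧
      (∀ x : X, x ≠ 0 → 0 < V x ∧ V x ≤ ψ₂ ‖x‖₊) ∧
      ∀ (x : X) (d : Sys.disturbances), Sys.diniDeriv V d x ≤ ((-(α ‖x‖₊ : ℝ) : ℝ) : EReal)

end DynSystem

end NonCoerciveLyapunov

/-!
All properties are tied to uniform global attractivity.

From a non-coercive Lyapunov function `V` to attractivity: integrating the Dini inequality shows
that, while a trajectory stays outside a ball of radius `η`, the function `V` decreases at rate at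
least `α η`. As `0 ≤ V x ≤ ψ₂ ‖x‖`, this can last only for a time bounded in terms of `‖x‖` and `η`,
so that trajectories reach every ball about `0` within a uniform time. The same budget argument and
the robustness of the equilibrium give uniform stability
(`IsNonCoerciveLyapunov.uniformlyStable`), which keeps the trajectory near `0` afterwards
(`IsNonCoerciveLyapunov.ugatt`).

From attractivity to a bound of class `KL`: the supremum of the norms reached after time `t` from
the ball of radius `r` is finite by robust forward completeness, monotone in `r`, antitone in `t`
and has the right limits. Averaging it in both variables gives a continuous majorant
(`exists_isClassKL_ge`).

From attractivity to a coercive Lyapunov function: for `η > 0` let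
`U_η(x) = sup_{t, d} exp t * max (‖φ(t, x, d)‖ - η) 0`. Over a ball of initial values only a bounded
time interval matters, so `U_η` is Lipschitz there, and the concatenation axiom gives
`U_η(φ(t, x, d)) ≤ exp (-t) * U_η(x)`. A suitably weighted series of the functions `U_{1/(k+1)}` is
the Lyapunov function (`UGATT.exists_isCoerciveLyapunov`). Concatenation at time `t` keeps the value
of the first disturbance at `t`, so one needs to know that the flow does not depend on the value of
the disturbance at time `0`; this follows from the Lipschitz continuity of the flow
(`flow_eq_of_eqOn_Ioc`).
-/

open Filter Topology Set

namespace NonCoerciveLyapunov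

namespace DynSystem

variable {X S : Type*} [NormedAddCommGroup X] [NormedSpace ℝ X]
  [NormedAddCommGroup S] [NormedSpace ℝ S]

/-! ### Trajectories and concatenation -/

/-- The value of the disturbance at time `0` does not influence the flow: after an arbitrarily short
time `s` the two trajectories are driven by the same disturbance, and as `s` tends to `0` their
distance at time `s` tends to `0`. -/
theorem flow_eq_of_eqOn_Ioc (Sys : DynSystem X S) (hLip : Sys.LipschitzFlow)
    {t : ℝ≥0} (x : X) {d d' : Sys.disturbances}
    (h : ∀ s : ℝ≥0, 0 < s → s ≤ t → d.1 s = d'.1 s) : Sys.flow t x d = Sys.flow t x d' := by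
  rcases eq_or_lt_of_le (zero_le (a := t)) with rfl | ht
  · rw [Sys.flow_zero, Sys.flow_zero]
  obtain ⟨L, -, hL⟩ := hLip t ht (‖x‖ + 1) (by positivity)
  have key : ∀ e : Sys.disturbances, Tendsto (fun s => Sys.flow s x e) (𝓝[>] 0) (𝓝 x) := by
    intro e
    have h0 := (Sys.continuous_flow x e).tendsto 0
    rw [Sys.flow_zero] at h0
    exact h0.mono_left nhdsWithin_le_nhds
  have hball : ∀ e : Sys.disturbances, ∀ᶠ s in 𝓝[>] (0 : ℝ≥0), ‖Sys.flow s x e‖ ≤ ‖x‖ + 1 :=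
    fun e => ((key e).norm.eventually_lt_const (lt_add_one ‖x‖)).mono fun _ => le_of_lt
  have hbound : ∀ᶠ s in 𝓝[>] (0 : ℝ≥0),
      ‖Sys.flow t x d - Sys.flow t x d'‖ ≤ L * ‖Sys.flow s x d - Sys.flow s x d'‖ := by
    filter_upwards [hball d, hball d', self_mem_nhdsWithin,
      mem_nhdsWithin_of_mem_nhds (Iio_mem_nhds ht)] with s hs hs' hs0 hst
    have hle : s ≤ t := le_of_lt hst
    have hsplit : ∀ e : Sys.disturbances, Sys.flow t x e =
        Sys.flow (t - s) (Sys.flow s x e) ⟨timeShift s e.1, Sys.shift_mem e.1 e.2 s⟩ := by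
      intro e
      rw [Sys.cocycle, add_tsub_cancel_of_le hle]
    rw [hsplit d, hsplit d', Sys.causality (t - s) (Sys.flow s x d')
      ⟨timeShift s d'.1, Sys.shift_mem d'.1 d'.2 s⟩ ⟨timeShift s d.1, Sys.shift_mem d.1 d.2 s⟩]
    · exact hL _ _ hs hs' _ tsub_le_self _
    · intro u hu
      exact (h (s + u) (lt_of_lt_of_le hs0 le_self_add)
        ((add_le_add_right hu s).trans (add_tsub_cancel_of_le hle).le)).symm
  have hlim : Tendsto (fun s => L * ‖Sys.flow s x d - Sys.flow s x d'‖) (𝓝[>] (0 : ℝ≥0)) (𝓝 0) := by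
    simpa using (((key d).sub (key d')).norm).const_mul L
  exact sub_eq_zero.1 (norm_le_zero_iff.1 (ge_of_tendsto hlim hbound))

/-- Trajectories can be prolonged by other trajectories. The shifted concatenation agrees with `d'`
only at positive times, so that causality alone does not suffice here. -/
theorem exists_flow_add_eq (Sys : DynSystem X S) (hLip : Sys.LipschitzFlow)
    (t s : ℝ≥0) (x : X) (d d' : Sys.disturbances) :
    ∃ e : Sys.disturbances, Sys.flow (t + s) x e = Sys.flow s (Sys.flow t x d) d' := by
  rcases eq_or_lt_of_le (zero_le (a := t)) with rfl | ht
  · exact ⟨d', by rw [zero_add, Sys.flow_zero]⟩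
  refine ⟨⟨concat t d.1 d'.1, Sys.concat_mem _ d.2 _ d'.2 t ht⟩, ?_⟩
  rw [← Sys.cocycle, Sys.causality t x _ d fun u hu => by simp [concat, hu]]
  refine Sys.flow_eq_of_eqOn_Ioc hLip _ fun u hu _ => ?_
  simp [concat, timeShift, hu.ne']

/-! ### From a Lyapunov function to attractivity -/

/-- A bound on the Dini derivative along a trajectory integrates to a decay estimate. -/
theorem flow_le_sub_of_diniDeriv_le (Sys : DynSystem X S) {V : X → ℝ≥0} (hV : Continuous V)
    (x : X) (d : Sys.disturbances) {a b : ℝ≥0} (hab : a ≤ b) {c : ℝ}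
    (h : ∀ t : ℝ≥0, a ≤ t → t ≤ b →
      Sys.diniDeriv V ⟨timeShift t d.1, Sys.shift_mem d.1 d.2 t⟩ (Sys.flow t x d)
        ≤ ((-c : ℝ) : EReal)) :
    (V (Sys.flow b x d) : ℝ) ≤ V (Sys.flow a x d) - c * (b - a) := by
  set f : ℝ → ℝ := fun s => V (Sys.flow s.toNNReal x d) with hf
  have hfc : Continuous f := NNReal.continuous_coe.comp
    (hV.comp ((Sys.continuous_flow x d).comp continuous_real_toNNReal))
  have := image_le_of_liminf_slope_right_le_deriv_boundary (f := f) (a := a) (b := b)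
    (B := fun s => f a - c * (s - a)) (B' := fun _ => -c) hfc.continuousOn (by simp)
    (by fun_prop) (fun s _ => by
      have h1 : HasDerivAt (fun s : ℝ => f a - c * (s - a)) (-(c * 1)) s :=
        (((hasDerivAt_id s).sub_const (a : ℝ)).const_mul c).const_sub (f a)
      simpa using h1.hasDerivWithinAt) ?_ (x := b) ⟨by exact_mod_cast hab, le_rfl⟩
  · simpa [hf] using this
  · intro s hs r hr
    lift s to ℝ≥0 using a.2.trans hs.1
    have hd := h s (by exact_mod_cast hs.1) (by exact_mod_cast hs.2.le)
    have hfreq := frequently_lt_of_liminf_lt (h := hd.trans_lt (EReal.coe_lt_coe_iff.2 hr))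
    have htend : Tendsto (fun u : ℝ≥0 => (s : ℝ) + u) (𝓝[>] 0) (𝓝[>] (s : ℝ)) := by
      refine tendsto_nhdsWithin_iff.2 ⟨?_, ?_⟩
      · have : Tendsto (fun u : ℝ≥0 => (s : ℝ) + u) (𝓝 0) (𝓝 ((s : ℝ) + (0 : ℝ≥0))) :=
          Continuous.tendsto (by fun_prop) _
        simpa using this.mono_left nhdsWithin_le_nhds
      · filter_upwards [self_mem_nhdsWithin] with u hu
        have : (0 : ℝ) < u := by exact_mod_cast hu
        simpa using hu
    refine htend.frequently (hfreq.mono fun u hu => ?_)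
    have hu' := EReal.coe_lt_coe_iff.1 hu
    rw [Sys.cocycle] at hu'
    have e1 : ((s : ℝ) + u).toNNReal = s + u := by
      rw [← NNReal.coe_add, Real.toNNReal_coe]
    simpa [slope_def_field, hf, e1] using hu'

/-- A trajectory that leaves the `ε`-ball at a time `t ≥ 1` has stayed outside some `η`-ball during
the preceding unit of time, because the equilibrium is robust. This decreases `V` by at least
`α η`, more than its initial value `V x ≤ ψ₂ ‖x‖` if `‖x‖` is small. -/
theorem IsNonCoerciveLyapunov.uniformlyStable {Sys : DynSystem X S} {V : X → ℝ≥0}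
    (hV : Sys.IsNonCoerciveLyapunov V) (hREP : Sys.ZeroIsRobustEquilibrium) {ε : ℝ} (hε : 0 < ε) :
    ∃ δ : ℝ, 0 < δ ∧ ∀ (t : ℝ≥0) (x : X) (d : Sys.disturbances), ‖x‖ ≤ δ →
      ‖Sys.flow t x d‖ ≤ ε := by
  obtain ⟨hc, hV0, ψ₂, α, hψ, hα, hup, hdini⟩ := hV
  obtain ⟨η, hη, hηε⟩ := hREP.2 ε hε 1 one_pos
  have hαη : 0 < α η.toNNReal := by
    rw [← hα.2.2]; exact hα.2.1 (Real.toNNReal_pos.2 hη)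
  have hψη : ∀ᶠ r in 𝓝 (0 : ℝ≥0), ψ₂ r < α η.toNNReal := by
    refine (hψ.1.1.tendsto 0).eventually_lt_const ?_
    rwa [hψ.1.2.2]
  have hVle : ∀ x, V x ≤ ψ₂ ‖x‖₊ := by
    intro x
    by_cases hx : x = 0
    · simp [hx, hV0]
    · exact (hup x hx).2
  obtain ⟨ρ, hρ, hρη⟩ := Metric.eventually_nhds_iff.1 hψη
  refine ⟨min η (ρ / 2), by positivity, fun t x d hx => ?_⟩
  rcases le_total t 1 with ht | ht
  · exact hηε t x d ht (hx.trans (min_le_left _ _))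
  by_contra! hlt
  have hanti : (V (Sys.flow (t - 1) x d) : ℝ) ≤ V x := by
    have := Sys.flow_le_sub_of_diniDeriv_le hc x d (zero_le : 0 ≤ t - 1) (c := 0)
      fun s _ _ => (hdini _ _).trans (EReal.coe_le_coe_iff.2 (by simp))
    simpa [Sys.flow_zero] using this
  have hcost := Sys.flow_le_sub_of_diniDeriv_le hc x d (tsub_le_self : t - 1 ≤ t)
    (c := α η.toNNReal) fun s hs hst => by
      refine (hdini _ _).trans (EReal.coe_le_coe_iff.2 (neg_le_neg ?_))
      refine NNReal.coe_le_coe.2 (hα.2.1.monotone ?_)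
      rw [Real.toNNReal_le_iff_le_coe, coe_nnnorm]
      by_contra! hsm
      have h1 := hηε (t - s) (Sys.flow s x d) ⟨timeShift s d.1, Sys.shift_mem d.1 d.2 s⟩
        (tsub_le_iff_tsub_le.1 hs) hsm.le
      rw [Sys.cocycle, add_tsub_cancel_of_le hst] at h1
      exact h1.not_gt hlt
  rw [NNReal.coe_sub ht] at hcost
  have h2 : (V x : ℝ) < α η.toNNReal := by
    refine NNReal.coe_lt_coe.2 ((hVle x).trans_lt (hρη ?_))
    rw [NNReal.dist_eq]
    simp only [coe_nnnorm, NNReal.coe_zero, sub_zero, abs_norm]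
    exact (hx.trans (min_le_right _ _)).trans_lt (by linarith)
  have h3 := (V (Sys.flow t x d)).2
  simp only [NNReal.val_eq_coe, NNReal.coe_one] at h3 hcost
  linarith

/-- A trajectory cannot avoid the `δ`-ball of stability for longer than `ψ₂ r / α δ`, as `V` would
become negative. -/
theorem IsNonCoerciveLyapunov.ugatt {Sys : DynSystem X S} {V : X → ℝ≥0}
    (hV : Sys.IsNonCoerciveLyapunov V) (hREP : Sys.ZeroIsRobustEquilibrium) : Sys.UGATT := by
  intro r ε hr hε
  obtain ⟨δ, hδ, hstab⟩ := hV.uniformlyStable hREP hε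
  obtain ⟨hc, hV0, ψ₂, α, hψ, hα, hup, hdini⟩ := hV
  have hαδ : 0 < α δ.toNNReal := by
    rw [← hα.2.2]; exact hα.2.1 (Real.toNNReal_pos.2 hδ)
  -- the summand `1` makes `V` strictly negative at the end of the interval
  refine ⟨(ψ₂ r.toNNReal + 1) / α δ.toNNReal, fun x d t hx ht => ?_⟩
  set τ := (ψ₂ r.toNNReal + 1) / α δ.toNNReal with hτ
  obtain ⟨s, hs, hsδ⟩ : ∃ s ≤ τ, ‖Sys.flow s x d‖ ≤ δ := by
    by_contra! hfar
    have hcost := Sys.flow_le_sub_of_diniDeriv_le hc x d (zero_le : 0 ≤ τ) (c := α δ.toNNReal)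
      fun s _ hs => by
        refine (hdini _ _).trans (EReal.coe_le_coe_iff.2 (neg_le_neg ?_))
        refine NNReal.coe_le_coe.2 (hα.2.1.monotone ?_)
        rw [Real.toNNReal_le_iff_le_coe, coe_nnnorm]
        exact (hfar s hs).le
    have hVx : (V x : ℝ) ≤ ψ₂ r.toNNReal := by
      by_cases hx0 : x = 0
      · simp [hx0, hV0]
      · refine NNReal.coe_le_coe.2 ((hup x hx0).2.trans (hψ.1.2.1.monotone ?_))
        rwa [Real.le_toNNReal_iff_coe_le hr.le, coe_nnnorm]
    have hprod : (α δ.toNNReal : ℝ) * τ = ψ₂ r.toNNReal + 1 := by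
      rw [← NNReal.coe_mul, hτ, mul_div_cancel₀ _ hαδ.ne']; simp
    have h3 := (V (Sys.flow τ x d)).2
    simp only [NNReal.val_eq_coe, NNReal.coe_zero, sub_zero, Sys.flow_zero] at h3 hcost
    linarith
  have h1 := hstab (t - s) (Sys.flow s x d) ⟨timeShift s d.1, Sys.shift_mem d.1 d.2 s⟩ hsδ
  rwa [Sys.cocycle, add_tsub_cancel_of_le (hs.trans ht)] at h1

/-! ### The direct implications -/

theorem UGAS.ugatt {Sys : DynSystem X S} (h : Sys.UGAS) : Sys.UGATT := by
  obtain ⟨β, hβ, hflow⟩ := h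
  intro r ε hr hε
  have hr' := Real.toNNReal_pos.2 hr
  obtain ⟨τ, hτ⟩ := ((hβ.2 _ hr').2.2.eventually_le_const (Real.toNNReal_pos.2 hε)).exists
  refine ⟨τ, fun x d t hx ht => ?_⟩
  rw [← coe_nnnorm, ← Real.le_toNNReal_iff_coe_le hε.le]
  refine (hflow x d t).trans ((((hβ.1 t).2.1.monotone ?_).trans ((hβ.2 _ hr').2.1 ht)).trans hτ)
  rwa [Real.le_toNNReal_iff_coe_le hr.le, coe_nnnorm]

theorem IsCoerciveLyapunov.isNonCoerciveLyapunov {Sys : DynSystem X S} {V : X → ℝ≥0}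
    (hV : Sys.IsCoerciveLyapunov V) : Sys.IsNonCoerciveLyapunov V := by
  obtain ⟨hc, ψ₁, ψ₂, α, h₁, h₂, hα, hb, hd⟩ := hV
  refine ⟨hc, ?_, ψ₂, α, h₂, hα, fun x hx => ⟨?_, (hb x).2⟩, hd⟩
  · have := (hb 0).2
    rwa [nnnorm_zero, h₂.1.2.2, nonpos_iff_eq_zero] at this
  · refine lt_of_lt_of_le ?_ (hb x).1
    rw [← h₁.1.2.2]
    exact h₁.1.2.1 (nnnorm_pos.2 hx)

end DynSystem

/-! ### Majorants of class `K∞` and `KL` -/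

theorem isClassK_toNNReal {F : ℝ → ℝ} (hc : Continuous F) (hF : StrictMonoOn F (Ici 0))
    (h0 : F 0 = 0) : IsClassK fun r : ℝ≥0 => (F r).toNNReal := by
  refine ⟨by fun_prop, fun r s hrs => ?_, by simp [h0]⟩
  have hlt : F r < F s := hF r.2 s.2 (by exact_mod_cast hrs)
  refine (Real.toNNReal_lt_toNNReal_iff_of_nonneg ?_).2 hlt
  rw [← h0]
  exact hF.monotoneOn self_mem_Ici r.2 r.2

theorem isClassKInf_toNNReal {F : ℝ → ℝ} (hc : Continuous F) (hF : StrictMonoOn F (Ici 0))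
    (h0 : F 0 = 0) (hlim : Tendsto F atTop atTop) :
    IsClassKInf fun r : ℝ≥0 => (F r).toNNReal := by
  refine ⟨isClassK_toNNReal hc hF h0, fun ⟨M, hM⟩ => ?_⟩
  obtain ⟨r, hr, hr0⟩ := ((hlim.eventually_gt_atTop (M : ℝ)).and (eventually_ge_atTop 0)).exists
  have := hM ⟨r.toNNReal, rfl⟩
  dsimp only at this
  rw [Real.coe_toNNReal r hr0, Real.toNNReal_le_iff_le_coe] at this
  exact this.not_gt hr

/-- The average of `g` over `[r, 2 r]`, written on a fixed interval of integration. -/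
noncomputable def dilationAverage (g : ℝ → ℝ) (r : ℝ) : ℝ :=
  ∫ u in (1 : ℝ)..2, g (u * r)

section DilationAverage

variable {g : ℝ → ℝ}

theorem intervalIntegrable_comp_mul_right (hg : Monotone g) {r : ℝ} (hr : 0 ≤ r) (a b : ℝ) :
    IntervalIntegrable (fun u => g (u * r)) MeasureTheory.volume a b :=
  (hg.comp (monotone_mul_right_of_nonneg hr)).intervalIntegrable

theorem le_dilationAverage (hg : Monotone g) {r : ℝ} (hr : 0 ≤ r) :
    g r ≤ dilationAverage g r := by
  have := intervalIntegral.integral_mono_on (one_le_two : (1 : ℝ) ≤ 2)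
    (intervalIntegrable_const (c := g r)) (intervalIntegrable_comp_mul_right hg hr 1 2)
    fun u hu => hg (le_mul_of_one_le_left hr hu.1)
  simpa [dilationAverage, show (2 : ℝ) - 1 = 1 by norm_num] using this

theorem dilationAverage_le (hg : Monotone g) {r : ℝ} (hr : 0 ≤ r) :
    dilationAverage g r ≤ g (2 * r) := by
  have := intervalIntegral.integral_mono_on (one_le_two : (1 : ℝ) ≤ 2)
    (intervalIntegrable_comp_mul_right hg hr 1 2) (intervalIntegrable_const (c := g (2 * r)))
    fun u hu => hg (mul_le_mul_of_nonneg_right hu.2 hr)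
  simpa [dilationAverage, show (2 : ℝ) - 1 = 1 by norm_num] using this

theorem monotoneOn_dilationAverage (hg : Monotone g) :
    MonotoneOn (dilationAverage g) (Ici 0) := fun _ hr _ hs hrs =>
  intervalIntegral.integral_mono_on one_le_two (intervalIntegrable_comp_mul_right hg hr 1 2)
    (intervalIntegrable_comp_mul_right hg hs 1 2)
    fun _ hu => hg (mul_le_mul_of_nonneg_left hrs (zero_le_one.trans hu.1))

theorem dilationAverage_eq_zero (hg0 : ∀ r ≤ 0, g r = 0) {r : ℝ} (hr : r ≤ 0) :
    dilationAverage g r = 0 := by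
  rw [dilationAverage, intervalIntegral.integral_congr (g := fun _ => 0),
    intervalIntegral.integral_zero]
  intro u hu
  rw [uIcc_of_le one_le_two] at hu
  exact hg0 _ (mul_nonpos_of_nonneg_of_nonpos (zero_le_one.trans hu.1) hr)

theorem continuous_dilationAverage (hg : Monotone g) (hg0 : ∀ r ≤ 0, g r = 0)
    (hlim : Tendsto g (𝓝 0) (𝓝 0)) : Continuous (dilationAverage g) := by
  have hint : ∀ a b, IntervalIntegrable g MeasureTheory.volume a b :=
    fun _ _ => hg.intervalIntegrable
  have hprim := intervalIntegral.continuous_primitive hint 0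
  refine continuous_iff_continuousAt.2 fun r => ?_
  rcases eq_or_ne r 0 with rfl | hr
  · rw [ContinuousAt, dilationAverage_eq_zero hg0 le_rfl]
    have h2 : Tendsto (fun s : ℝ => g (2 * s)) (𝓝 0) (𝓝 0) := by
      refine hlim.comp ?_
      simpa using (continuous_const_mul (2 : ℝ)).tendsto 0
    have hnn : ∀ s, 0 ≤ g s := fun s => by
      rcases le_total s 0 with h | h
      · rw [hg0 s h]
      · rw [← hg0 0 le_rfl]; exact hg h
    refine tendsto_of_tendsto_of_tendsto_of_le_of_le tendsto_const_nhds h2 (fun s => ?_)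
      fun s => ?_
    · exact intervalIntegral.integral_nonneg one_le_two fun u _ => hnn _
    · rcases le_total s 0 with h | h
      · rw [dilationAverage_eq_zero hg0 h]; exact hnn _
      · exact dilationAverage_le hg h
  · have heq : dilationAverage g =ᶠ[𝓝 r]
        fun s => s⁻¹ * ((∫ v in (0 : ℝ)..s * 2, g v) - ∫ v in (0 : ℝ)..s, g v) := by
      filter_upwards [isOpen_ne.mem_nhds hr] with s hs
      rw [intervalIntegral.integral_interval_sub_left (hint _ _) (hint _ _), dilationAverage,
        intervalIntegral.integral_comp_mul_right _ hs]
      simp [mul_comm]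
    refine ContinuousAt.congr ?_ heq.symm
    exact (continuousAt_inv₀ hr).mul
      ((hprim.comp (continuous_mul_const 2)).sub hprim).continuousAt

/-- A monotone function vanishing at `0`, and continuous there, has a majorant of class `K∞`. -/
theorem exists_isClassKInf_ge (hg : Monotone g) (hg0 : ∀ r ≤ 0, g r = 0)
    (hlim : Tendsto g (𝓝 0) (𝓝 0)) :
    ∃ ψ : ℝ≥0 → ℝ≥0, IsClassKInf ψ ∧ ∀ r : ℝ≥0, g r ≤ ψ r := by
  have hmono := monotoneOn_dilationAverage hg
  have hz := dilationAverage_eq_zero hg0 le_rfl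
  refine ⟨_, isClassKInf_toNNReal (F := fun r => dilationAverage g r + r)
    ((continuous_dilationAverage hg hg0 hlim).add continuous_id)
    (hmono.add_strictMono strictMonoOn_id) (by simp [hz]) ?_, fun r => ?_⟩
  · refine tendsto_atTop_mono' _ ?_ tendsto_id
    filter_upwards [eventually_ge_atTop 0] with r hr
    have := hmono self_mem_Ici hr hr
    simp only [id]
    linarith
  · refine le_trans ?_ (Real.le_coe_toNNReal _)
    have := le_dilationAverage hg r.2
    exact this.trans (le_add_of_nonneg_right r.2)

end DilationAverage

theorem exists_isClassKInf_ge_of_bounded_on_balls {E : Type*} [NormedAddCommGroup E] {W : E → ℝ}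
    (hW : ContinuousAt W 0) (h0 : W 0 = 0) (hb : ∀ r, ∃ b, ∀ x, ‖x‖ ≤ r → W x ≤ b) :
    ∃ ψ : ℝ≥0 → ℝ≥0, IsClassKInf ψ ∧ ∀ x, W x ≤ ψ ‖x‖₊ := by
  set g : ℝ → ℝ := fun r => sSup (insert 0 (W '' {x | ‖x‖ ≤ r})) with hg
  have hbdd : ∀ r, BddAbove (insert 0 (W '' {x | ‖x‖ ≤ r})) := fun r => by
    obtain ⟨b, hb⟩ := hb r
    exact BddAbove.insert _ ⟨b, forall_mem_image.2 hb⟩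
  have hle : ∀ r b, 0 ≤ b → (∀ x, ‖x‖ ≤ r → W x ≤ b) → g r ≤ b := fun r b hb h => by
    refine csSup_le (insert_nonempty _ _) ?_
    rintro y (rfl | ⟨x, hx, rfl⟩)
    exacts [hb, h x hx]
  have hge : ∀ x r, ‖x‖ ≤ r → W x ≤ g r := fun x r hx =>
    le_csSup (hbdd r) (mem_insert_of_mem _ ⟨x, hx, rfl⟩)
  have hgnn : ∀ r, 0 ≤ g r := fun r => le_csSup (hbdd r) (mem_insert _ _)
  have hlim : Tendsto g (𝓝 0) (𝓝 0) := by
    refine tendsto_order.2 ⟨fun a ha => Eventually.of_forall fun r => ha.trans_le (hgnn r),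
      fun ε hε => ?_⟩
    have hev : ∀ᶠ x in 𝓝 (0 : E), W x < ε / 2 :=
      hW.eventually_lt_const (by rw [h0]; exact half_pos hε)
    obtain ⟨δ, hδ, hδε⟩ := Metric.eventually_nhds_iff.1 hev
    filter_upwards [Iio_mem_nhds hδ] with r hr
    refine (hle r _ (half_pos hε).le fun x hx => ?_).trans_lt (half_lt_self hε)
    exact (hδε (by rw [dist_zero_right]; exact hx.trans_lt hr)).le
  obtain ⟨ψ, hψ, hgψ⟩ := exists_isClassKInf_ge (g := g)
    (fun r s h => hle r _ (hgnn s) fun x hx => hge x s (hx.trans h))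
    (fun r hr => (hle r 0 le_rfl fun x hx => by
      rw [norm_le_zero_iff.1 (hx.trans hr), h0]).antisymm (hgnn r)) hlim
  exact ⟨ψ, hψ, fun x => (hge x ‖x‖ le_rfl).trans (hgψ ‖x‖₊)⟩

/-- A bound that is monotone in the size of the initial value and antitone in time, and has the
limits of a function of class `KL`, is dominated by a function of class `KL`. -/
theorem exists_isClassKL_ge {ω : ℝ → ℝ → ℝ} (hmono : ∀ t, Monotone fun r => ω r t)
    (hanti : ∀ r, Antitone (ω r)) (hzero : ∀ r ≤ 0, ∀ t, ω r t = 0)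
    (hconst : ∀ r, ∀ t ≤ 0, ω r t = ω r 0)
    (hlim : ∀ r, Tendsto (ω r) atTop (𝓝 0)) (hlim0 : Tendsto (fun r => ω r 0) (𝓝 0) (𝓝 0)) :
    ∃ β : ℝ≥0 → ℝ≥0 → ℝ≥0, IsClassKL β ∧ ∀ r t : ℝ≥0, ω r t ≤ β r t := by
  have hnn : ∀ r t, 0 ≤ ω r t := fun r t => (hanti r).le_of_tendsto (hlim r) t
  have hle0 : ∀ r t, ω r t ≤ ω r 0 := fun r t => by
    rcases le_total t 0 with h | h
    · exact (hconst r t h).le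
    · exact hanti r h
  have hint : ∀ r a b, IntervalIntegrable (ω r) MeasureTheory.volume a b :=
    fun r _ _ => (hanti r).intervalIntegrable
  have hintS : ∀ r t a b, IntervalIntegrable (fun v => ω r (t - v)) MeasureTheory.volume a b :=
    fun r t _ _ => Monotone.intervalIntegrable fun _ _ h => hanti r (sub_le_sub_left h t)
  -- averaging over the preceding unit of time makes the bound continuous in time
  set A : ℝ → ℝ → ℝ := fun r t => ∫ v in (0 : ℝ)..1, ω r (t - v) with hA
  have hAmono : ∀ t, Monotone fun r => A r t := fun t r s hrs =>
    intervalIntegral.integral_mono_on zero_le_one (hintS r t 0 1) (hintS s t 0 1)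
      fun _ _ => hmono _ hrs
  have hAanti : ∀ r, Antitone (A r) := fun r t s hts =>
    intervalIntegral.integral_mono_on zero_le_one (hintS r s 0 1) (hintS r t 0 1)
      fun _ _ => hanti r (sub_le_sub_right hts _)
  have hAzero : ∀ r ≤ 0, ∀ t, A r t = 0 := fun r hr t => by simp [hA, hzero r hr]
  have hAge : ∀ r t, ω r t ≤ A r t := fun r t => by
    have := intervalIntegral.integral_mono_on (zero_le_one (α := ℝ))
      (intervalIntegrable_const (c := ω r t)) (hintS r t 0 1)
      fun v hv => hanti r (sub_le_self t hv.1)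
    simpa [hA] using this
  have hAle : ∀ r t, A r t ≤ ω r (t - 1) := fun r t => by
    have := intervalIntegral.integral_mono_on (zero_le_one (α := ℝ)) (hintS r t 0 1)
      (intervalIntegrable_const (c := ω r (t - 1)))
      fun v hv => hanti r (sub_le_sub_left hv.2 t)
    simpa [hA] using this
  have hAcont : ∀ r, Continuous (A r) := fun r => by
    have hprim := intervalIntegral.continuous_primitive (hint r) 0
    have heq : A r = fun t => (∫ v in (0 : ℝ)..t, ω r v) - ∫ v in (0 : ℝ)..t - 1, ω r v := by
      funext t
      rw [intervalIntegral.integral_interval_sub_left (hint r _ _) (hint r _ _), hA]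
      simp [intervalIntegral.integral_comp_sub_left]
    rw [heq]
    exact hprim.sub (hprim.comp (continuous_sub_right 1))
  have hAnn : ∀ r t, 0 ≤ A r t := fun r t => (hnn r t).trans (hAge r t)
  have hAle0 : ∀ r t, A r t ≤ ω r 0 := fun r t => (hAle r t).trans (hle0 _ _)
  have hAlim0 : ∀ t, Tendsto (fun r => A r t) (𝓝 0) (𝓝 0) := fun t =>
    squeeze_zero (fun r => hAnn r t) (fun r => hAle0 r t) hlim0
  have hAlim : ∀ r, Tendsto (A r) atTop (𝓝 0) := fun r =>
    squeeze_zero (hAnn r) (hAle r) ((hlim r).comp (tendsto_atTop_add_const_right _ _ tendsto_id))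
  -- averaging over dilations of the size makes the bound continuous in the size as well
  set B : ℝ → ℝ → ℝ := fun r t => dilationAverage (fun s => A s t) r with hB
  have hBnn : ∀ r t, 0 ≤ B r t := fun r t =>
    intervalIntegral.integral_nonneg one_le_two fun u _ => hAnn _ t
  have hBanti : ∀ r, 0 ≤ r → Antitone (B r) := fun r hr t s hts =>
    intervalIntegral.integral_mono_on one_le_two
      (intervalIntegrable_comp_mul_right (hAmono s) hr 1 2)
      (intervalIntegrable_comp_mul_right (hAmono t) hr 1 2) fun u _ => hAanti _ hts
  have hBcont : ∀ r, 0 ≤ r → Continuous (B r) := fun r hr => by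
    refine intervalIntegral.continuous_of_dominated_interval (bound := fun _ => ω (2 * r) 0)
      (fun t => ?_) (fun t => ?_) intervalIntegrable_const ?_
    · exact ((hAmono t).comp (monotone_mul_right_of_nonneg hr)).measurable.aestronglyMeasurable
    · refine Eventually.of_forall fun u hu => ?_
      rw [uIoc_of_le one_le_two] at hu
      rw [Real.norm_of_nonneg (hAnn _ _)]
      exact (hAle0 _ _).trans (hmono 0 (mul_le_mul_of_nonneg_right hu.2 hr))
    · exact Eventually.of_forall fun u _ => hAcont _
  have hBlim : ∀ r, 0 ≤ r → Tendsto (B r) atTop (𝓝 0) := fun r hr =>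
    squeeze_zero (hBnn r) (fun t => dilationAverage_le (hAmono t) hr) (hAlim (2 * r))
  refine ⟨fun r t => (B r t + r * Real.exp (-t)).toNNReal, ⟨fun t => ?_, fun r _ => ⟨?_, ?_, ?_⟩⟩,
    fun r t => ?_⟩
  · refine isClassK_toNNReal (F := fun r => B r t + r * Real.exp (-t)) ?_ ?_ ?_
    · exact (continuous_dilationAverage (hAmono t) (fun r hr => hAzero r hr t) (hAlim0 t)).add
        (continuous_mul_const _)
    · exact (monotoneOn_dilationAverage (hAmono t)).add_strictMono
        ((strictMono_mul_right_of_pos (Real.exp_pos _)).strictMonoOn _)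
    · simp [hB, dilationAverage_eq_zero (fun r hr => hAzero r hr t) le_rfl]
  · have := hBcont r r.2
    fun_prop
  · intro t s hts
    have := hBanti r r.2 (NNReal.coe_le_coe.2 hts)
    dsimp only
    gcongr
  · have h1 := (hBlim r r.2).add
      ((Real.tendsto_exp_atBot.comp tendsto_neg_atTop_atBot).const_mul (r : ℝ))
    have h2 := (continuous_real_toNNReal.tendsto _).comp
      (h1.comp (NNReal.tendsto_coe_atTop.2 tendsto_id))
    simpa [Function.comp_def] using h2
  · refine le_trans ?_ (Real.le_coe_toNNReal _)
    refine le_add_of_le_of_nonneg ?_ (by positivity)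
    exact (hAge r t).trans (le_dilationAverage (hAmono t) r.2)

/-! ### Series that are dominated on balls -/

/-- A series of functions that is dominated by a summable sequence on every ball is continuous. -/
theorem continuous_tsum_of_norm_le_on_balls {E : Type*} [NormedAddCommGroup E] {f : ℕ → E → ℝ}
    (hf : ∀ k, Continuous (f k))
    (hb : ∀ n : ℕ, ∃ u : ℕ → ℝ, Summable u ∧ ∀ k x, ‖x‖ ≤ n + 1 → ‖f k x‖ ≤ u k) :
    Continuous fun x => ∑' k, f k x := by
  refine continuous_iff_continuousAt.2 fun x => ?_
  obtain ⟨n, hn⟩ := exists_nat_ge ‖x‖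
  obtain ⟨u, hu, hfu⟩ := hb n
  refine (continuousOn_tsum (s := Metric.ball 0 (n + 1)) (fun k => (hf k).continuousOn) hu
    fun k y hy => hfu k y ?_).continuousAt (Metric.isOpen_ball.mem_nhds ?_)
  · exact (mem_ball_zero_iff.1 hy).le
  · exact mem_ball_zero_iff.2 (hn.trans_lt (lt_add_one _))

/-- Positive weights that make every row of a double sequence summable. -/
theorem exists_weights_summable_mul (L : ℕ → ℕ → ℝ) (hL : ∀ n k, 0 ≤ L n k) :
    ∃ c : ℕ → ℝ, (∀ k, 0 < c k) ∧ Summable c ∧ ∀ n, Summable fun k => c k * L n k := by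
  have hgeo : Summable fun k : ℕ => ((1 : ℝ) / 2) ^ k := summable_geometric_two
  have hs : ∀ k, 0 ≤ ∑ n ∈ Finset.range (k + 1), L n k := fun k =>
    Finset.sum_nonneg fun n _ => hL n k
  have hden : ∀ k, 0 < 1 + ∑ n ∈ Finset.range (k + 1), L n k := fun k => by
    have := hs k
    linarith
  -- the `k`-th weight takes care of the rows `n ≤ k`, that is, of all but finitely many entries of
  -- each row
  refine ⟨fun k => (1 / 2) ^ k / (1 + ∑ n ∈ Finset.range (k + 1), L n k),
    fun k => div_pos (by positivity) (hden k), ?_, fun n => ?_⟩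
  · refine Summable.of_nonneg_of_le (fun k => (div_pos (by positivity) (hden k)).le)
      (fun k => div_le_self (by positivity) ?_) hgeo
    have := hs k
    linarith
  · refine Summable.of_norm_bounded_eventually_nat hgeo ?_
    filter_upwards [eventually_ge_atTop n] with k hk
    rw [Real.norm_of_nonneg (mul_nonneg (div_pos (by positivity) (hden k)).le (hL n k)),
      div_mul_eq_mul_div]
    refine (div_le_iff₀ (hden k)).2 (mul_le_mul_of_nonneg_left ?_ (by positivity))
    have := Finset.single_le_sum (f := fun n => L n k) (fun m _ => hL m k)
      (Finset.mem_range.2 (Nat.lt_succ_of_le hk))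
    linarith

namespace DynSystem

variable {X S : Type*} [NormedAddCommGroup X] [NormedSpace ℝ X]
  [NormedAddCommGroup S] [NormedSpace ℝ S]

/-! ### From uniform attractivity to a bound of class `KL` -/

/-- The supremum of the norms reached at times `s ≥ t` from initial values of norm at most `r`. The
value `0` is added to the set so that it is nonempty, also for `r < 0` or without disturbances. -/
noncomputable def tailBound (Sys : DynSystem X S) (r t : ℝ) : ℝ :=
  sSup (insert 0 {y : ℝ | ∃ (x : X) (s : ℝ≥0) (d : Sys.disturbances),
    ‖x‖ ≤ r ∧ t ≤ s ∧ y = ‖Sys.flow s x d‖})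

theorem tailBound_le {Sys : DynSystem X S} {r t b : ℝ} (hb : 0 ≤ b)
    (h : ∀ (x : X) (s : ℝ≥0) (d : Sys.disturbances), ‖x‖ ≤ r → t ≤ s → ‖Sys.flow s x d‖ ≤ b) :
    Sys.tailBound r t ≤ b := by
  refine csSup_le (insert_nonempty _ _) ?_
  rintro y (rfl | ⟨x, s, d, hx, hs, rfl⟩)
  exacts [hb, h x s d hx hs]

/-- Robust forward completeness bounds the trajectories until attractivity takes over. -/
theorem UGATT.bddAbove_norm_flow {Sys : DynSystem X S} (hU : Sys.UGATT)
    (hRFC : Sys.RobustlyForwardComplete) (r t : ℝ) :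
    BddAbove (insert 0 {y : ℝ | ∃ (x : X) (s : ℝ≥0) (d : Sys.disturbances),
      ‖x‖ ≤ r ∧ t ≤ s ∧ y = ‖Sys.flow s x d‖}) := by
  refine BddAbove.insert _ ?_
  have hr : 0 < max r 1 := lt_max_of_lt_right one_pos
  obtain ⟨τ, hτ⟩ := hU (max r 1) 1 hr one_pos
  obtain ⟨b, hb⟩ := hRFC (max r 1) hr (τ + 1) (by positivity)
  refine ⟨max b 1, ?_⟩
  rintro y ⟨x, s, d, hx, -, rfl⟩
  have hx' := hx.trans (le_max_left r 1)
  rcases le_total s τ with h | h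
  · exact le_max_of_le_left (hb ⟨x, s, d, hx', h.trans le_self_add, rfl⟩)
  · exact le_max_of_le_right (hτ x d s hx' h)

theorem UGATT.ugas {Sys : DynSystem X S} (hU : Sys.UGATT) (hRFC : Sys.RobustlyForwardComplete)
    (hREP : Sys.ZeroIsRobustEquilibrium) : Sys.UGAS := by
  have hbdd := hU.bddAbove_norm_flow hRFC
  have hnn : ∀ r t, 0 ≤ Sys.tailBound r t := fun r t => le_csSup (hbdd r t) (mem_insert _ _)
  have hflow : ∀ (r t : ℝ) (x : X) (s : ℝ≥0) (d : Sys.disturbances), ‖x‖ ≤ r → t ≤ s →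
      ‖Sys.flow s x d‖ ≤ Sys.tailBound r t := fun r t x s d hx hs =>
    le_csSup (hbdd r t) (mem_insert_of_mem _ ⟨x, s, d, hx, hs, rfl⟩)
  have hlim : ∀ r, Tendsto (Sys.tailBound r) atTop (𝓝 0) := fun r => by
    refine tendsto_order.2 ⟨fun a ha => Eventually.of_forall fun t => ha.trans_le (hnn r t),
      fun ε hε => ?_⟩
    obtain ⟨τ, hτ⟩ := hU (max r 1) (ε / 2) (lt_max_of_lt_right one_pos) (half_pos hε)
    filter_upwards [eventually_ge_atTop (τ : ℝ)] with t ht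
    refine (tailBound_le (half_pos hε).le fun x s d hx hs => ?_).trans_lt (half_lt_self hε)
    exact hτ x d s (hx.trans (le_max_left _ _)) (by exact_mod_cast ht.trans hs)
  have hlim0 : Tendsto (fun r => Sys.tailBound r 0) (𝓝 0) (𝓝 0) := by
    refine tendsto_order.2 ⟨fun a ha => Eventually.of_forall fun r => ha.trans_le (hnn r 0),
      fun ε hε => ?_⟩
    -- attractivity controls the times after `τ`, robustness of the equilibrium those before
    obtain ⟨τ, hτ⟩ := hU 1 (ε / 2) one_pos (half_pos hε)
    obtain ⟨δ, hδ, hδε⟩ := hREP.2 (ε / 2) (half_pos hε) (τ + 1) (by positivity)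
    filter_upwards [Iio_mem_nhds (lt_min hδ one_pos)] with r hr
    refine (tailBound_le (half_pos hε).le fun x s d hx _ => ?_).trans_lt (half_lt_self hε)
    rw [mem_Iio, lt_min_iff] at hr
    rcases le_total s τ with h | h
    · exact hδε s x d (h.trans le_self_add) (hx.trans hr.1.le)
    · exact hτ x d s (hx.trans hr.2.le) h
  obtain ⟨β, hβ, hle⟩ := exists_isClassKL_ge (ω := Sys.tailBound)
    (fun t r r' h => tailBound_le (hnn _ _) fun x s d hx hs => hflow _ _ x s d (hx.trans h) hs)
    (fun r t t' h => tailBound_le (hnn _ _) fun x s d hx hs => hflow _ _ x s d hx (h.trans hs))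
    (fun r hr t => (tailBound_le le_rfl fun x s d hx _ => by
      rw [norm_le_zero_iff.1 (hx.trans hr), hREP.1, norm_zero]).antisymm (hnn r t))
    (fun r t ht => (tailBound_le (hnn _ _) fun x s d hx _ => hflow _ _ x s d hx s.2).antisymm
      (tailBound_le (hnn _ _) fun x s d hx hs => hflow _ _ x s d hx (ht.trans hs)))
    hlim hlim0
  refine ⟨β, hβ, fun x d t => ?_⟩
  rw [← NNReal.coe_le_coe]
  exact (hflow ‖x‖ t x t d le_rfl le_rfl).trans (hle ‖x‖₊ t)

/-! ### The excess functions -/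

/-- The exponentially weighted excess of the norm over the threshold `η` along the trajectories from
`x`, as a supremum over all times and disturbances. A real `⨆`; `bddAbove_excess` shows that it is a
genuine supremum for uniformly attractive systems. -/
noncomputable def excessFunction (Sys : DynSystem X S) (η : ℝ) (x : X) : ℝ :=
  ⨆ p : ℝ≥0 × Sys.disturbances, Real.exp p.1 * max (‖Sys.flow p.1 x p.2‖ - η) 0

/-- By attractivity only a bounded time interval matters for the excess function, and there the
flow is Lipschitz. -/
theorem UGATT.exists_excess_le {Sys : DynSystem X S} (hU : Sys.UGATT) (hLip : Sys.LipschitzFlow)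
    {R η : ℝ} (hR : 0 < R) (hη : 0 < η) :
    ∃ L : ℝ, 0 ≤ L ∧ ∀ x y : X, ‖x‖ ≤ R → ‖y‖ ≤ R → ∀ p : ℝ≥0 × Sys.disturbances,
      Real.exp p.1 * max (‖Sys.flow p.1 x p.2‖ - η) 0 ≤
        Real.exp p.1 * max (‖Sys.flow p.1 y p.2‖ - η) 0 + L * ‖x - y‖ := by
  obtain ⟨τ, hτ⟩ := hU R η hR hη
  obtain ⟨L, hL0, hL⟩ := hLip (τ + 1) (by positivity) R hR
  refine ⟨Real.exp τ * L, by positivity, fun x y hx hy ⟨t, d⟩ => ?_⟩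
  dsimp only
  rcases le_total τ t with h | h
  · rw [max_eq_right (sub_nonpos.2 (hτ x d t hx h)), mul_zero]
    positivity
  · have h1 : max (‖Sys.flow t x d‖ - η) 0 ≤ max (‖Sys.flow t y d‖ - η) 0 + L * ‖x - y‖ := by
      have h2 := hL x y hx hy t (h.trans le_self_add) d
      have h3 := norm_sub_norm_le (Sys.flow t x d) (Sys.flow t y d)
      have h4 := le_max_left (‖Sys.flow t y d‖ - η) 0
      have h5 := le_max_right (‖Sys.flow t y d‖ - η) 0
      refine max_le ?_ ?_
      · linarith
      · have : 0 ≤ L * ‖x - y‖ := by positivity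
        linarith
    calc _ ≤ Real.exp t * (max (‖Sys.flow t y d‖ - η) 0 + L * ‖x - y‖) := by gcongr
      _ = Real.exp t * max (‖Sys.flow t y d‖ - η) 0 + Real.exp t * L * ‖x - y‖ := by ring
      _ ≤ _ := by gcongr

section Excess

variable {Sys : DynSystem X S} {η : ℝ}

theorem excessFunction_nonneg (x : X) : 0 ≤ Sys.excessFunction η x :=
  Real.iSup_nonneg fun _ => by positivity

theorem excessFunction_zero (hzero : Sys.ZeroIsEquilibrium) (hη : 0 < η) :
    Sys.excessFunction η 0 = 0 := by
  simp [excessFunction, hzero _ _, hη.le]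

theorem bddAbove_excess (hU : Sys.UGATT) (hLip : Sys.LipschitzFlow)
    (hzero : Sys.ZeroIsEquilibrium) (hη : 0 < η) (x : X) :
    BddAbove (range fun p : ℝ≥0 × Sys.disturbances =>
      Real.exp p.1 * max (‖Sys.flow p.1 x p.2‖ - η) 0) := by
  obtain ⟨L, -, hL⟩ := hU.exists_excess_le hLip (R := ‖x‖ + 1) (by positivity) hη
  refine ⟨L * ‖x‖, ?_⟩
  rintro _ ⟨p, rfl⟩
  simpa [hzero _ _, hη.le] using hL x 0 (by linarith) (by simp; positivity) p

theorem exists_excessFunction_le (hU : Sys.UGATT) (hLip : Sys.LipschitzFlow)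
    (hzero : Sys.ZeroIsEquilibrium) {R : ℝ} (hR : 0 < R) (hη : 0 < η) :
    ∃ L : ℝ, 0 ≤ L ∧ ∀ x y : X, ‖x‖ ≤ R → ‖y‖ ≤ R →
      Sys.excessFunction η x ≤ Sys.excessFunction η y + L * ‖x - y‖ := by
  obtain ⟨L, hL0, hL⟩ := hU.exists_excess_le hLip hR hη
  refine ⟨L, hL0, fun x y hx hy => Real.iSup_le (fun p => ?_) ?_⟩
  · exact (hL x y hx hy p).trans
      (add_le_add_left (le_ciSup (bddAbove_excess hU hLip hzero hη y) p) _)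
  · have := excessFunction_nonneg (Sys := Sys) (η := η) y
    positivity

theorem continuous_excessFunction (hU : Sys.UGATT) (hLip : Sys.LipschitzFlow)
    (hzero : Sys.ZeroIsEquilibrium) (hη : 0 < η) : Continuous (Sys.excessFunction η) := by
  refine continuous_iff_continuousAt.2 fun x => ?_
  obtain ⟨L, hL0, hL⟩ := exists_excessFunction_le hU hLip hzero (R := ‖x‖ + 1) (by positivity) hη
  refine LipschitzOnWith.continuousOn (K := L.toNNReal) (s := Metric.ball 0 (‖x‖ + 1))
    (LipschitzOnWith.of_le_add_mul _ fun y hy z hz => ?_) |>.continuousAt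
    (Metric.isOpen_ball.mem_nhds (by simp))
  rw [Real.coe_toNNReal L hL0, dist_eq_norm]
  exact hL y z (mem_ball_zero_iff.1 hy).le (mem_ball_zero_iff.1 hz).le

theorem max_norm_sub_le_excessFunction (hU : Sys.UGATT) (hLip : Sys.LipschitzFlow)
    (hzero : Sys.ZeroIsEquilibrium) (hη : 0 < η) (d : Sys.disturbances) (x : X) :
    max (‖x‖ - η) 0 ≤ Sys.excessFunction η x := by
  simpa [Sys.flow_zero, excessFunction] using le_ciSup (bddAbove_excess hU hLip hzero hη x) (0, d)

/-- Trajectories from `φ(t, x, d)` are, up to a time shift by `t`, trajectories from `x`; the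
exponential weight turns the shift into decay. -/
theorem excessFunction_flow_le (hU : Sys.UGATT) (hLip : Sys.LipschitzFlow)
    (hzero : Sys.ZeroIsEquilibrium) (hη : 0 < η) (t : ℝ≥0) (x : X) (d : Sys.disturbances) :
    Sys.excessFunction η (Sys.flow t x d) ≤ Real.exp (-t) * Sys.excessFunction η x := by
  refine Real.iSup_le (fun ⟨s, d'⟩ => ?_) (mul_nonneg (Real.exp_pos _).le (excessFunction_nonneg x))
  obtain ⟨e, he⟩ := Sys.exists_flow_add_eq hLip t s x d d'
  have := le_ciSup (bddAbove_excess hU hLip hzero hη x) (t + s, e)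
  dsimp only at this ⊢
  rw [he] at this
  refine le_trans (le_of_eq ?_) (mul_le_mul_of_nonneg_left this (Real.exp_pos (-(t : ℝ))).le)
  rw [← mul_assoc, ← Real.exp_add]
  simp

end Excess

/-! ### The converse Lyapunov theorem -/

/-- Exponential decay along trajectories with rate `1`, differentiated at time `0`. -/
theorem diniDeriv_le_neg_of_flow_le {Sys : DynSystem X S} {V : X → ℝ≥0} {x : X}
    {d : Sys.disturbances}
    (h : ∀ t : ℝ≥0, (V (Sys.flow t x d) : ℝ) ≤ Real.exp (-t) * V x) :
    Sys.diniDeriv V d x ≤ ((-(V x : ℝ) : ℝ) : EReal) := by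
  have hder : HasDerivAt (fun t : ℝ => Real.exp (-t) * V x) (-(V x : ℝ)) 0 := by
    simpa using ((hasDerivAt_neg (0 : ℝ)).exp).mul_const (V x : ℝ)
  have hcoe : Tendsto (fun t : ℝ≥0 => (t : ℝ)) (𝓝[>] 0) (𝓝[≠] 0) := by
    refine tendsto_nhdsWithin_iff.2 ⟨?_, ?_⟩
    · exact (NNReal.continuous_coe.tendsto' 0 0 rfl).mono_left nhdsWithin_le_nhds
    · filter_upwards [self_mem_nhdsWithin] with t ht
      exact NNReal.coe_ne_zero.2 (ne_of_gt ht)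
  have hlim : Tendsto (fun t : ℝ≥0 => (((Real.exp (-t) * V x - V x) / t : ℝ) : EReal))
      (𝓝[>] 0) (𝓝 ((-(V x : ℝ) : ℝ) : EReal)) := by
    refine (continuous_coe_real_ereal.tendsto _).comp ?_
    have := hder.tendsto_slope.comp hcoe
    simpa [Function.comp_def, slope_def_field] using this
  rw [← hlim.liminf_eq, diniDeriv]
  refine liminf_le_liminf (Eventually.of_forall fun t => EReal.coe_le_coe_iff.2 ?_)
  exact div_le_div_of_nonneg_right (sub_le_sub_right (h t) _) t.2

/-- The Lyapunov function is a weighted series of the excess functions with thresholds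
`1 / (k + 1)`. Each of them decays exponentially along trajectories, hence so does the sum, and its
upper and lower bounds in terms of the norm are inherited term by term. -/
theorem UGATT.exists_isCoerciveLyapunov {Sys : DynSystem X S} (hU : Sys.UGATT)
    (hLip : Sys.LipschitzFlow) (hzero : Sys.ZeroIsEquilibrium) :
    ∃ V : X → ℝ≥0, Sys.IsCoerciveLyapunov V := by
  rcases isEmpty_or_nonempty Sys.disturbances with hD | ⟨⟨d₀⟩⟩
  · -- without disturbances there are no trajectories, and the norm will do
    have hid : IsClassKInf id :=
      ⟨⟨continuous_id, strictMono_id, rfl⟩, by simp⟩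
    exact ⟨fun x => ‖x‖₊, continuous_nnnorm, id, id, id, hid, hid, hid.1,
      fun x => ⟨le_rfl, le_rfl⟩, fun x d => isEmptyElim d⟩
  set η : ℕ → ℝ := fun k => 1 / ((k : ℝ) + 1) with hη
  have hηpos : ∀ k, 0 < η k := fun k => by positivity
  set U : ℕ → X → ℝ := fun k => Sys.excessFunction (η k) with hUdef
  have hUnn : ∀ k x, 0 ≤ U k x := fun k x => excessFunction_nonneg x
  have hUzero : ∀ k, U k 0 = 0 := fun k => excessFunction_zero hzero (hηpos k)
  -- `L n k` is a Lipschitz constant of the `k`-th excess function on the ball of radius `n + 1`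
  choose L hL0 hL using fun n k : ℕ =>
    exists_excessFunction_le hU hLip hzero (R := (n : ℝ) + 1) (by positivity) (hηpos k)
  obtain ⟨c, hc, hcs, hcL⟩ := exists_weights_summable_mul L hL0
  have hUle : ∀ (n k : ℕ) x, ‖x‖ ≤ n + 1 → c k * U k x ≤ c k * L n k * (n + 1) := by
    intro n k x hx
    have h1 := hL n k x 0 hx (by rw [norm_zero]; positivity)
    rw [excessFunction_zero hzero (hηpos k), sub_zero, zero_add] at h1
    rw [mul_assoc]
    exact mul_le_mul_of_nonneg_left
      (h1.trans (mul_le_mul_of_nonneg_left hx (hL0 n k))) (hc k).le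
  have hterm : ∀ k x, 0 ≤ c k * U k x := fun k x => mul_nonneg (hc k).le (hUnn k x)
  have hsum : ∀ x, Summable fun k => c k * U k x := fun x => by
    obtain ⟨n, hn⟩ := exists_nat_ge ‖x‖
    exact Summable.of_nonneg_of_le (fun k => hterm k x)
      (fun k => hUle n k x (hn.trans (le_add_of_nonneg_right zero_le_one)))
      ((hcL n).mul_right _)
  set W : X → ℝ := fun x => ∑' k, c k * U k x with hW
  have hWnn : ∀ x, 0 ≤ W x := fun x => tsum_nonneg fun k => hterm k x
  have hWcont : Continuous W := by
    refine continuous_tsum_of_norm_le_on_balls (fun k => continuous_const.mul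
      (continuous_excessFunction hU hLip hzero (hηpos k))) fun n =>
      ⟨_, (hcL n).mul_right ((n : ℝ) + 1), fun k x hx => ?_⟩
    rw [Real.norm_of_nonneg (hterm k x)]
    exact hUle n k x hx
  have hWzero : W 0 = 0 := by simp [hW, hUzero]
  have hWflow : ∀ (t : ℝ≥0) x d, W (Sys.flow t x d) ≤ Real.exp (-t) * W x := fun t x d => by
    rw [hW]
    dsimp only
    rw [← tsum_mul_left]
    refine (hsum _).tsum_le_tsum (fun k => ?_) ((hsum x).mul_left _)
    rw [mul_left_comm]
    exact mul_le_mul_of_nonneg_left (excessFunction_flow_le hU hLip hzero (hηpos k) t x d) (hc k).le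
  -- the lower bound is the same series with the excess of the initial value
  have hlnn : ∀ k (r : ℝ), 0 ≤ c k * max (r - η k) 0 := fun k r =>
    mul_nonneg (hc k).le (le_max_right _ _)
  have hlle : ∀ (b : ℝ) k (r : ℝ), 0 ≤ b → r ≤ b → c k * max (r - η k) 0 ≤ c k * b :=
    fun b k r hb hr => mul_le_mul_of_nonneg_left
      (max_le (by have := hηpos k; linarith) hb) (hc k).le
  have hlsum : ∀ r : ℝ, Summable fun k => c k * max (r - η k) 0 := fun r =>
    Summable.of_nonneg_of_le (fun k => hlnn k r)
      (fun k => hlle |r| k r (abs_nonneg r) (le_abs_self r)) (hcs.mul_right _)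
  set F : ℝ → ℝ := fun r => ∑' k, c k * max (r - η k) 0 with hF
  have hFcont : Continuous F := by
    refine continuous_tsum_of_norm_le_on_balls (fun k => by fun_prop) fun n =>
      ⟨_, hcs.mul_right ((n : ℝ) + 1), fun k r hr => ?_⟩
    rw [Real.norm_of_nonneg (hlnn k r)]
    exact hlle _ k r (by positivity) ((le_abs_self r).trans hr)
  have hFzero : F 0 = 0 := by
    have : ∀ k, max (0 - η k) 0 = 0 := fun k => max_eq_right (by have := hηpos k; linarith)
    simp only [hF, this, mul_zero, tsum_zero]
  have hFstrict : StrictMonoOn F (Ici 0) := by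
    intro r hr s _ hrs
    -- some threshold lies below `s`, and its term increases strictly
    obtain ⟨k, hk⟩ := exists_nat_one_div_lt (lt_of_le_of_lt (mem_Ici.1 hr) hrs)
    refine Summable.tsum_lt_tsum (i := k) (fun j => ?_) ?_ (hlsum r) (hlsum s)
    · exact mul_le_mul_of_nonneg_left
        (max_le_max (sub_le_sub_right hrs.le _) le_rfl) (hc j).le
    · refine mul_lt_mul_of_pos_left ?_ (hc k)
      have hk' : 0 < s - η k := sub_pos.2 hk
      exact (max_lt (sub_lt_sub_right hrs _) hk').trans_le (le_max_left _ _)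
  have hFtop : Tendsto F atTop atTop := by
    refine tendsto_atTop_mono (fun r => ?_)
      ((tendsto_atTop_add_const_right _ (-η 0) tendsto_id).const_mul_atTop (hc 0))
    refine le_trans ?_ ((hlsum r).le_tsum 0 fun k _ => hlnn k r)
    exact mul_le_mul_of_nonneg_left (le_max_left _ _) (hc 0).le
  have hFW : ∀ x, F ‖x‖ ≤ W x := fun x =>
    (hlsum _).tsum_le_tsum (fun k => mul_le_mul_of_nonneg_left
      (max_norm_sub_le_excessFunction hU hLip hzero (hηpos k) d₀ x) (hc k).le) (hsum x)
  obtain ⟨ψ₂, hψ₂, hWψ⟩ := exists_isClassKInf_ge_of_bounded_on_balls hWcont.continuousAt hWzero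
    fun r => by
      obtain ⟨n, hn⟩ := exists_nat_ge r
      exact ⟨_, fun x hx => (hsum x).tsum_le_tsum
        (fun k => hUle n k x (hx.trans (hn.trans (le_add_of_nonneg_right zero_le_one))))
        ((hcL n).mul_right _)⟩
  have hψ₁ := isClassKInf_toNNReal hFcont hFstrict hFzero hFtop
  have hlow : ∀ x, (F ‖x‖).toNNReal ≤ (W x).toNNReal := fun x => Real.toNNReal_le_toNNReal (hFW x)
  refine ⟨fun x => (W x).toNNReal, by fun_prop, _, ψ₂, _, hψ₁, hψ₂, hψ₁.1,
    fun x => ⟨hlow x, Real.toNNReal_le_iff_le_coe.2 (hWψ x)⟩, fun x d => ?_⟩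
  refine (diniDeriv_le_neg_of_flow_le fun t => ?_).trans
    (EReal.coe_le_coe_iff.2 (neg_le_neg (NNReal.coe_le_coe.2 (hlow x))))
  rw [Real.coe_toNNReal _ (hWnn _), Real.coe_toNNReal _ (hWnn _)]
  exact hWflow t x d

end DynSystem

end NonCoerciveLyapunov

theorem mainTheorem3 {X S : Type*} [NormedAddCommGroup X] [NormedSpace ℝ X]
    [NormedAddCommGroup S] [NormedSpace ℝ S]
    (Sys : NonCoerciveLyapunov.DynSystem X S)
    (hLip : Sys.LipschitzFlow)
    (hRFC : Sys.RobustlyForwardComplete)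
    (hREP : Sys.ZeroIsRobustEquilibrium) :
    List.TFAE [
      Sys.UGAS,
      Sys.UGATT,
      ∃ V : X → ℝ≥0, Sys.IsCoerciveLyapunov V,
      ∃ V : X → ℝ≥0, Sys.IsNonCoerciveLyapunov V] := by
  tfae_have 1 → 2 := fun h => h.ugatt
  tfae_have 2 → 1 := fun h => h.ugas hRFC hREP
  tfae_have 2 → 3 := fun h => h.exists_isCoerciveLyapunov hLip hREP.1
  tfae_have 3 → 4 := fun ⟨V, hV⟩ => ⟨V, hV.isNonCoerciveLyapunov⟩
  tfae_have 4 → 2 := fun ⟨_, hV⟩ => hV.ugatt hREP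
  tfae_finish
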